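/- Notation. A real $r$ is computable if $\{q\in\mathbb{Q}: q<r\}$ and $\{q\in\mathbb{Q}: q<-r\}$ are computably enumerable. On $\{0,1\}^{\mathbb{Z}}\times\{0,1\}^{\mathbb{Z}}$ (spins $x$, scatterers $y$) let $$\varphi(x,y)(i)=\bigl(x(i-1)+y(i-1)-2x(i-1)y(i-1),\;y(i)\bigr),\qquad \pi(x,y)(i)=\bigl(x(-i),\,y(-i-1)\bigr)$$ be one time step of the Kac infinite chain and the time-reversal transformation. For $m=(m_0,m_1)\in[-1,1]\times[0,1]$ let $\mu_m=\mu_{(1+m_0)/2}\times\mu_{m_1}$, where $\mu_p$ is the Bernoulli measure on $\{0,1\}^{\mathbb{Z}}$ (independent coordinates, each equal to $1$ with probability $p$), and let $\mu_{m,t}=\mu_m\circ\varphi^{-t}$ be the image of $\mu_m$ under $\varphi^t$, the measure at time $t$. For a probability measure $\mu$ on $\{0,1\}^{\mathbb{N}}$, a sequence $z$ is Martin-Löf $\mu$-random if there is no sequence $(U_n)_{n\in\mathbb{N}}$ of sets, c.e. open uniformly in $n$, with $\mu(U_n)\le 2^{-n}$ and $z\in U_n$ for all $n$. A pair $(x,y)\in\{0,1\}^{\mathbb{Z}}\times\{0,1\}^{\mathbb{Z}}$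 is Martin-Löf random with respect to $\mu$ if its code $\kappa(\iota(x),\iota(y))$ is Martin-Löf random with respect to the image of $\mu$ under this coding, where $\iota(x)=x(0)x(-1)x(1)x(-2)x(2)\cdots$ and $\kappa(a,b)=a(0)b(0)a(1)b(1)\cdots$. Theorem (non-randomness of the time-reversed state). Let $m_0\in[-1,1]$ and $m_1\in[0,1]$ be computable reals with $m_0\neq 0$ and $m_1\notin\{0,\tfrac12,1\}$. Then for every $(x,y)$ that is Martin-Löf random with respect to $\mu_m$ and every integer $t\ge 1$, the time-reversed state $(\pi\circ\varphi^t)(x,y)$ is not Martin-Löf random with respect to $\mu_{m,t}$. -/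

import Mathlib

open MeasureTheory ProbabilityTheory
open scoped ENNReal

/-! ### Computable reals -/

/-- The rational number `(-1)^s * p / (q + 1)` named by the triple `(s, p, q)`. -/
def codedRat (c : Bool × ℕ × ℕ) : ℚ :=
  (if c.1 then -1 else 1) * ((c.2.1 : ℚ) / ((c.2.2 : ℚ) + 1))

/-- `r` is lower semicomputable: the set of rationals `< r` is computably enumerable. -/
def LowerSemicomputable (r : ℝ) : Prop :=
  REPred fun c : Bool × ℕ × ℕ => ((codedRat c : ℚ) : ℝ) < r

/-- `r` is computable: both `r` and `-r` are lower semicomputable. -/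
def ComputableReal (r : ℝ) : Prop :=
  LowerSemicomputable r ∧ LowerSemicomputable (-r)

/-! ### Martin-Löf randomness in Cantor space -/

/-- The cylinder `[σ]`: all infinite binary sequences having `σ` as a prefix. -/
def cylinderSet (σ : List Bool) : Set (ℕ → Bool) :=
  {x | ∀ (i : ℕ) (hi : i < σ.length), x i = σ[i]}

/-- `U 0, U 1, …` are c.e. open, uniformly in the index. -/
def UniformlyCEOpen (U : ℕ → Set (ℕ → Bool)) : Prop :=
  ∃ S : ℕ → Set (List Bool),
    (REPred fun p : ℕ × List Bool => p.2 ∈ S p.1) ∧ ∀ n, U n = ⋃ σ ∈ S n, cylinderSet σ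

/-- A Martin-Löf test with respect to `μ`. -/
def IsMLTest (μ : Measure (ℕ → Bool)) (U : ℕ → Set (ℕ → Bool)) : Prop :=
  UniformlyCEOpen U ∧ ∀ n, μ (U n) ≤ (2⁻¹ : ℝ≥0∞) ^ n

/-- Martin-Löf randomness on `{0,1}^ℕ`: `{z}` is not a Martin-Löf null set. -/
def MLRandomNat (μ : Measure (ℕ → Bool)) (z : ℕ → Bool) : Prop :=
  ¬ ∃ U : ℕ → Set (ℕ → Bool), IsMLTest μ U ∧ {z} ⊆ ⋂ n, U n

/-! ### Two-sided configurations and pairs of them -/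

/-- Microscopic states `(x, y)`, with spins `x` and scatterers `y` on the lattice `ℤ`. -/
abbrev MicroState : Type := (ℤ → Bool) × (ℤ → Bool)

/-- The coding `x ↦ x(0) x(-1) x(1) x(-2) x(2) …`. -/
def iotaCode (x : ℤ → Bool) : ℕ → Bool := fun n =>
  if n % 2 = 0 then x ((n / 2 : ℕ) : ℤ) else x (-(((n + 1) / 2 : ℕ) : ℤ))

/-- The coding `(x, y) ↦ x(0) y(0) x(1) y(1) …`. -/
def kappaCode (p : (ℕ → Bool) × (ℕ → Bool)) : ℕ → Bool := fun n =>
  if n % 2 = 0 then p.1 (n / 2) else p.2 (n / 2)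

/-- The coding of a microscopic state by one infinite binary sequence. -/
def stateCode (s : MicroState) : ℕ → Bool := kappaCode (iotaCode s.1, iotaCode s.2)

/-- Martin-Löf randomness of a microscopic state, through the coding. -/
def MLRandom (μ : Measure MicroState) (s : MicroState) : Prop :=
  MLRandomNat (μ.map stateCode) (stateCode s)

/-! ### The Kac infinite chain -/

/-- One time step: particles move one site to the right, and a spin is flipped exactly when
there is a scatterer at the site it leaves. -/
def kacStep (s : MicroState) : MicroState :=
  (fun i => xor (s.1 (i - 1)) (s.2 (i - 1)), s.2)

/-- The time-reversal transformation. -/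
def timeReversal (s : MicroState) : MicroState :=
  (fun i => s.1 (-i), fun i => s.2 (-i - 1))

/-- The Bernoulli measure on `{0,1}^ℤ`: independent sites, each equal to `1` with
probability `p`. -/
noncomputable def bernoulliInt (p : unitInterval) : Measure (ℤ → Bool) :=
  Measure.infinitePi fun _ : ℤ => bernoulliMeasure true false p

/-- The probability `(1 + m₀) / 2` of an up spin when the mean magnetization is `m₀`. -/
noncomputable def upProb (m₀ : Set.Icc (-1 : ℝ) 1) : unitInterval :=
  ⟨(1 + (m₀ : ℝ)) / 2, by
    have h := m₀.2
    constructor <;> linarith [h.1, h.2]⟩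

/-- The measure `μ_m`: a product of Bernoulli measures, of parameter `(1 + m₀) / 2` for the spins
and `m₁` for the scatterers. -/
noncomputable def gibbsMeasure (m₀ : Set.Icc (-1 : ℝ) 1) (m₁ : unitInterval) :
    Measure MicroState :=
  (bernoulliInt (upProb m₀)).prod (bernoulliInt m₁)

/-- The measure at time `t`: the image of `μ_m` under `t` time steps. -/
noncomputable def gibbsMeasureAt (m₀ : Set.Icc (-1 : ℝ) 1) (m₁ : unitInterval) (t : ℕ) :
    Measure MicroState :=
  (gibbsMeasure m₀ m₁).map (kacStep^[t])

/-!
A sequence that is Martin-Löf random for `ν` obeys the law of large numbers for every primitive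
recursive sequence of pairwise uncorrelated `0`-`1` observables with a common mean: along dyadic
averages, Chebyshev's inequality makes the deviation events a Martin-Löf test.

Let `φ = kacStep` and `π = timeReversal`, so that `φ^t π φ^t = π`, and give spins the values `±1`.
A state random for `μ_{m,t} = μ_m ∘ φ^{-t}` therefore shows the mean magnetization of `μ_m` after
`π` and a further `φ^t`. If the state is `(π ∘ φ^t) s`, this further evolution produces `φ^{2 t} s`,
and for random `s` the magnetization of `φ^{2 t} s` is damped by `(1 - 2 m₁)^{2 t}`, which lies in
`[0, 1)`: each spin picks up the signs of `2 t` independent scatterers. Sampling only the sites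
`2 t j` makes the observables uncorrelated.
-/

open Filter Topology

section PrimitiveRecursion

theorem primrec_sum_range {α : Type*} [Primcodable α] {f : α → ℕ → ℕ} (hf : Primrec₂ f)
    {n : α → ℕ} (hn : Primrec n) : Primrec fun a => ∑ j ∈ Finset.range (n a), f a j := by
  have hstep : Primrec₂ fun (a : α) (p : ℕ × ℕ) => p.2 + f a p.1 :=
    Primrec.nat_add.comp (Primrec.snd.comp Primrec.snd)
      (hf.comp Primrec.fst (Primrec.fst.comp Primrec.snd))
  refine (Primrec.nat_rec' hn (Primrec.const 0) hstep).of_eq fun a => ?_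
  induction n a with
  | zero => rfl
  | succ m ih => rw [Finset.sum_range_succ, ← ih]

theorem primrec_two_pow : Primrec fun k : ℕ => 2 ^ k :=
  (Primrec₂.unpaired'.1 Nat.Primrec.pow).comp (Primrec.const 2) Primrec.id

theorem encode_int_natCast (n : ℕ) : Encodable.encode (n : ℤ) = 2 * n := rfl

theorem encode_int_negSucc (n : ℕ) : Encodable.encode (Int.negSucc n) = 2 * n + 1 := rfl

theorem primrec_natCast_int : Primrec fun n : ℕ => (n : ℤ) :=
  Primrec.encode_iff.1 Primrec.nat_double

theorem primrec_natCast_int_mul (d : ℕ) : Primrec fun j : ℕ => (d * j : ℤ) := by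
  simpa using primrec_natCast_int.comp (Primrec.nat_mul.comp (.const d) .id)

theorem primrec_int_pred : Primrec fun i : ℤ => i - 1 := by
  have hcode : Primrec fun i : ℤ =>
      if Encodable.encode i = 0 then 1
      else if Encodable.encode i % 2 = 0 then Encodable.encode i - 2
      else Encodable.encode i + 2 :=
    .ite (Primrec.eq.comp .encode (.const 0)) (.const 1)
      (.ite (Primrec.eq.comp (Primrec.nat_mod.comp .encode (.const 2)) (.const 0))
        (Primrec.nat_sub.comp .encode (.const 2)) (Primrec.nat_add.comp .encode (.const 2)))
  refine Primrec.encode_iff.1 (hcode.of_eq fun i => ?_)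
  rcases i with (_ | n) | n
  · rfl
  · rw [show Int.ofNat (n + 1) - 1 = (n : ℤ) by simp, encode_int_natCast,
      Int.ofNat_eq_natCast, encode_int_natCast]
    grind
  · rw [show Int.negSucc n - 1 = Int.negSucc (n + 1) by omega, encode_int_negSucc,
      encode_int_negSucc]
    grind

theorem primrec_int_neg : Primrec fun i : ℤ => -i := by
  have hcode : Primrec fun i : ℤ =>
      if Encodable.encode i = 0 then 0
      else if Encodable.encode i % 2 = 0 then Encodable.encode i - 1
      else Encodable.encode i + 1 :=
    .ite (Primrec.eq.comp .encode (.const 0)) (.const 0)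
      (.ite (Primrec.eq.comp (Primrec.nat_mod.comp .encode (.const 2)) (.const 0))
        (Primrec.nat_sub.comp .encode (.const 1)) (Primrec.succ.comp .encode))
  refine Primrec.encode_iff.1 (hcode.of_eq fun i => ?_)
  rcases i with (_ | n) | n
  · rfl
  · rw [show -Int.ofNat (n + 1) = Int.negSucc n by rfl, encode_int_negSucc,
      Int.ofNat_eq_natCast, encode_int_natCast]
    grind
  · rw [show -Int.negSucc n = ((n + 1 : ℕ) : ℤ) by omega, encode_int_negSucc,
      encode_int_natCast]
    grind

end PrimitiveRecursion

/-- A primitive recursive family of functionals `X a : {0,1}^ℕ → β`: a primitive recursive `L a`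
bounds the part of the sequence that is read, and `F a` computes the value from any prefix of
length at least `L a`. -/
def PrimrecFunctional {α β : Type*} [Primcodable α] [Primcodable β]
    (X : α → (ℕ → Bool) → β) : Prop :=
  ∃ (L : α → ℕ) (F : α → List Bool → β), Primrec L ∧ Primrec₂ F ∧
    ∀ a w m, L a ≤ m → F a ((List.range m).map w) = X a w

namespace PrimrecFunctional

variable {α β γ δ : Type*} [Primcodable α] [Primcodable β] [Primcodable γ] [Primcodable δ]

theorem eval {f : α → ℕ} (hf : Primrec f) : PrimrecFunctional fun a w => w (f a) := by
  refine ⟨fun a => f a + 1, fun a σ => σ.getD (f a) false, Primrec.succ.comp hf,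
    (Primrec.list_getD false).comp Primrec.snd (hf.comp Primrec.fst), fun a w m hm => ?_⟩
  simp [List.getD, Nat.lt_of_succ_le hm]

theorem comp_index {X : α → (ℕ → Bool) → β} (hX : PrimrecFunctional X) {f : γ → α}
    (hf : Primrec f) : PrimrecFunctional fun c => X (f c) := by
  obtain ⟨L, F, hL, hF, hFX⟩ := hX
  exact ⟨fun c => L (f c), fun c => F (f c), hL.comp hf, hF.comp (hf.comp .fst) .snd,
    fun c => hFX (f c)⟩

theorem map₂ {X : α → (ℕ → Bool) → β} {Y : α → (ℕ → Bool) → γ} {g : β → γ → δ}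
    (hg : Primrec₂ g) (hX : PrimrecFunctional X) (hY : PrimrecFunctional Y) :
    PrimrecFunctional fun a w => g (X a w) (Y a w) := by
  obtain ⟨L, F, hL, hF, hFX⟩ := hX
  obtain ⟨M, G, hM, hG, hGY⟩ := hY
  exact ⟨fun a => max (L a) (M a), fun a σ => g (F a σ) (G a σ), Primrec.nat_max.comp hL hM,
    hg.comp hF hG, fun a w m hm => congrArg₂ g (hFX a w m ((le_max_left _ _).trans hm))
      (hGY a w m ((le_max_right _ _).trans hm))⟩

theorem map {X : α → (ℕ → Bool) → β} {g : α → β → γ} (hg : Primrec₂ g)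
    (hX : PrimrecFunctional X) : PrimrecFunctional fun a w => g a (X a w) := by
  obtain ⟨L, F, hL, hF, hFX⟩ := hX
  exact ⟨L, fun a σ => g a (F a σ), hL, hg.comp .fst hF,
    fun a w m hm => congrArg (g a) (hFX a w m hm)⟩

theorem sum_range {X : ℕ → (ℕ → Bool) → ℕ} (hX : PrimrecFunctional X) :
    PrimrecFunctional fun n w => ∑ j ∈ Finset.range n, X j w := by
  obtain ⟨L, F, hL, hF, hFX⟩ := hX
  refine ⟨fun n => ∑ j ∈ Finset.range n, L j, fun n σ => ∑ j ∈ Finset.range n, F j σ,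
    primrec_sum_range (hL.comp .snd).to₂ .id,
    primrec_sum_range (hF.comp .snd (Primrec.snd.comp .fst)).to₂ .fst, fun n w m hm => ?_⟩
  refine Finset.sum_congr rfl fun j hj => hFX j w m (le_trans ?_ hm)
  exact Finset.single_le_sum (fun _ _ => Nat.zero_le _) hj

theorem measurable [MeasurableSpace β] {X : α → (ℕ → Bool) → β} (hX : PrimrecFunctional X)
    (a : α) : Measurable (X a) := by
  obtain ⟨L, F, -, -, hFX⟩ := hX
  have hfactor : X a = (fun v : Fin (L a) → Bool => F a (List.ofFn v)) ∘ fun w i => w i := by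
    ext w
    rw [← hFX a w (L a) le_rfl, Function.comp_apply, List.ofFn_eq_map,
      ← List.map_coe_finRange_eq_range, List.map_map]
    rfl
  rw [hfactor]
  exact (measurable_of_countable _).comp (measurable_pi_lambda _ fun i => measurable_pi_apply _)

end PrimrecFunctional

section MartinLofTests

theorem mem_cylinderSet_iff {σ : List Bool} {w : ℕ → Bool} :
    w ∈ cylinderSet σ ↔ (List.range σ.length).map w = σ := by
  constructor
  · intro h
    refine List.ext_getElem (by simp) fun i hi hi' => ?_
    simpa using h i hi'
  · intro h i hi
    have := congrArg (fun l : List Bool => l[i]?) h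
    simpa [hi] using this

theorem mem_cylinderSet_prefix (w : ℕ → Bool) (m : ℕ) :
    w ∈ cylinderSet ((List.range m).map w) := by
  simp [mem_cylinderSet_iff]

theorem uniformlyCEOpen_iUnion_ge {A : ℕ → (ℕ → Bool) → Bool} (hA : PrimrecFunctional A)
    (c : ℕ) : UniformlyCEOpen fun n => ⋃ k ≥ n + c, {w | A k w = true} := by
  obtain ⟨L, F, hL, hF, hFA⟩ := hA
  let S : ℕ → Set (List Bool) := fun n =>
    {σ | ∃ k < σ.length, n + c ≤ k ∧ L k ≤ σ.length ∧ F k σ = true}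
  refine ⟨S, ?_, fun n => ?_⟩
  · have hR : PrimrecRel fun (k : ℕ) (p : ℕ × List Bool) =>
        p.1 + c ≤ k ∧ L k ≤ p.2.length ∧ F k p.2 = true := by
      have hn : Primrec fun x : ℕ × ℕ × List Bool => x.2.1 := Primrec.fst.comp .snd
      have hσ : Primrec fun x : ℕ × ℕ × List Bool => x.2.2 := Primrec.snd.comp .snd
      exact (Primrec.nat_le.comp (Primrec.nat_add.comp hn (.const c)) .fst).and
        ((Primrec.nat_le.comp (hL.comp .fst) (Primrec.list_length.comp hσ)).and
          (Primrec.eq.comp (hF.comp .fst hσ) (.const true)))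
    have hS := hR.exists_mem_list.comp
      (Primrec.list_range.comp (Primrec.list_length.comp Primrec.snd))
      (Primrec.id (α := ℕ × List Bool))
    simp only [List.mem_range] at hS
    exact hS.computablePred.to_re
  · ext w
    simp only [Set.mem_iUnion, exists_prop]
    constructor
    · rintro ⟨k, hk, hw⟩
      refine ⟨(List.range (max (L k) (k + 1))).map w, ⟨k, ?_, hk, ?_, ?_⟩,
        mem_cylinderSet_prefix w _⟩
      · simp
      · simp
      · rw [hFA k w _ (le_max_left _ _)]
        exact hw
    · rintro ⟨σ, ⟨k, -, hk, hLk, hF⟩, hw⟩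
      refine ⟨k, hk, ?_⟩
      rw [← mem_cylinderSet_iff.1 hw, hFA k w _ hLk] at hF
      exact hF

theorem measure_iUnion_ge_le_two_pow {Ω : Type*} [MeasurableSpace Ω] {μ : Measure Ω}
    {A : ℕ → Set Ω} {C : ℝ≥0∞} (hA : ∀ k, μ (A k) ≤ C * 2⁻¹ ^ k) (m : ℕ) :
    μ (⋃ k ≥ m, A k) ≤ C * 2 * 2⁻¹ ^ m := by
  calc μ (⋃ k ≥ m, A k) ≤ μ (⋃ i, A (m + i)) := by
        refine measure_mono (Set.iUnion₂_subset fun k hk => ?_)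
        obtain ⟨i, rfl⟩ := Nat.exists_eq_add_of_le hk
        exact Set.subset_iUnion (fun i => A (m + i)) i
    _ ≤ ∑' i, C * 2⁻¹ ^ (m + i) :=
        (measure_iUnion_le _).trans (ENNReal.tsum_le_tsum fun i => hA _)
    _ = C * 2 * 2⁻¹ ^ m := by
        simp_rw [pow_add, ENNReal.tsum_mul_left, ENNReal.tsum_geometric]
        rw [ENNReal.one_sub_inv_two, inv_inv]
        ring

theorem MLRandomNat.eventually_eq_false {ν : Measure (ℕ → Bool)} {z : ℕ → Bool}
    (hz : MLRandomNat ν z) {A : ℕ → (ℕ → Bool) → Bool} (hA : PrimrecFunctional A)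
    {C : ℝ≥0∞} (hC : C ≠ ⊤) (hν : ∀ k, ν {w | A k w = true} ≤ C * 2⁻¹ ^ k) :
    ∀ᶠ k in atTop, A k z = false := by
  by_contra hfreq
  simp only [not_eventually, Bool.not_eq_false] at hfreq
  obtain ⟨c, hc⟩ : ∃ c : ℕ, C * 2 ≤ 2 ^ c := by
    obtain ⟨c, hc⟩ := ENNReal.exists_nat_gt (ENNReal.mul_ne_top hC ENNReal.ofNat_ne_top (b := 2))
    exact ⟨c, hc.le.trans (mod_cast c.lt_two_pow_self.le)⟩
  refine hz ⟨_, ⟨uniformlyCEOpen_iUnion_ge hA c, fun n => ?_⟩, ?_⟩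
  · calc ν (⋃ k ≥ n + c, {w | A k w = true})
        ≤ C * 2 * 2⁻¹ ^ (n + c) := measure_iUnion_ge_le_two_pow hν _
      _ ≤ 2 ^ c * 2⁻¹ ^ (n + c) := by gcongr
      _ = 2⁻¹ ^ n := by
          rw [pow_add, mul_left_comm, ← mul_pow,
            ENNReal.mul_inv_cancel two_ne_zero ENNReal.ofNat_ne_top, one_pow, mul_one]
  · rintro _ rfl
    refine Set.mem_iInter.2 fun n => ?_
    obtain ⟨k, hk, hAk⟩ := frequently_atTop.1 hfreq (n + c)
    exact Set.mem_iUnion₂.2 ⟨k, hk, hAk⟩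

end MartinLofTests

section DyadicAverages

variable {Ω : Type*} [MeasurableSpace Ω] {μ : Measure Ω}

theorem variance_sum_le_of_pairwise_covariance_eq_zero {ι : Type*} [IsFiniteMeasure μ]
    {X : ι → Ω → ℝ} (hX : ∀ i, MemLp (X i) 2 μ)
    (hcov : Pairwise fun i j => cov[X i, X j; μ] = 0) {C : ℝ} (hvar : ∀ i, Var[X i; μ] ≤ C)
    (s : Finset ι) : Var[∑ i ∈ s, X i; μ] ≤ s.card * C := by
  calc Var[∑ i ∈ s, X i; μ] = ∑ i ∈ s, ∑ j ∈ s, cov[X i, X j; μ] :=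
        variance_sum' fun i _ => hX i
    _ = ∑ i ∈ s, Var[X i; μ] := by
        refine Finset.sum_congr rfl fun i hi => ?_
        rw [Finset.sum_eq_single_of_mem i hi fun j _ hji => hcov hji.symm,
          covariance_self (hX i).aemeasurable]
    _ ≤ s.card * C := by
        rw [← nsmul_eq_mul]
        exact Finset.sum_le_card_nsmul s _ C fun i _ => hvar i

theorem measure_le_abs_average_sub_le [IsFiniteMeasure μ] {X : ℕ → Ω → ℝ}
    (hX : ∀ j, MemLp (X j) 2 μ) {e : ℝ} (hmean : ∀ j, ∫ w, X j w ∂μ = e)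
    (hcov : Pairwise fun i j => cov[X i, X j; μ] = 0) {C : ℝ} (hvar : ∀ j, Var[X j; μ] ≤ C)
    {δ : ℝ} (hδ : 0 < δ) {N : ℕ} (hN : 0 < N) :
    μ {w | δ ≤ |(∑ j ∈ Finset.range N, X j w) / N - e|} ≤ ENNReal.ofReal (C / (δ ^ 2 * N)) := by
  have hN' : (0 : ℝ) < N := mod_cast hN
  have hsum : ∫ w, (∑ j ∈ Finset.range N, X j) w ∂μ = N * e := by
    simp only [Finset.sum_apply]
    rw [integral_finsetSum _ fun j _ => (hX j).integrable one_le_two]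
    simp [hmean]
  have hset : {w | δ ≤ |(∑ j ∈ Finset.range N, X j w) / N - e|} =
      {w | δ * N ≤ |(∑ j ∈ Finset.range N, X j) w - N * e|} := by
    ext w
    rw [Set.mem_ofPred_eq, Set.mem_ofPred_eq, Finset.sum_apply, ← le_div_iff₀ hN',
      ← abs_of_pos hN', ← abs_div, abs_of_pos hN', sub_div, mul_div_cancel_left₀ e hN'.ne']
  rw [hset, ← hsum]
  refine (meas_ge_le_variance_div_sq (memLp_finsetSum' _ fun j _ => hX j)
    (mul_pos hδ hN')).trans (ENNReal.ofReal_le_ofReal ?_)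
  have hV := variance_sum_le_of_pairwise_covariance_eq_zero hX hcov hvar (Finset.range N)
  rw [Finset.card_range] at hV
  calc _ ≤ N * C / (δ * N) ^ 2 := by gcongr
    _ = C / (δ ^ 2 * N) := by field_simp

/-- The average of the first `2 ^ k` terms of `x`. Along this subsequence Chebyshev's inequality
gives deviation probabilities that decay geometrically. -/
noncomputable def dyadicAverage (x : ℕ → ℝ) (k : ℕ) : ℝ :=
  (∑ j ∈ Finset.range (2 ^ k), x j) / 2 ^ k

theorem measure_le_abs_dyadicAverage_sub_le [IsFiniteMeasure μ] {X : ℕ → Ω → ℝ}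
    (hX : ∀ j, MemLp (X j) 2 μ) {e : ℝ} (hmean : ∀ j, ∫ w, X j w ∂μ = e)
    (hcov : Pairwise fun i j => cov[X i, X j; μ] = 0) {C : ℝ} (hvar : ∀ j, Var[X j; μ] ≤ C)
    {δ : ℝ} (hδ : 0 < δ) (k : ℕ) :
    μ {w | δ ≤ |dyadicAverage (X · w) k - e|} ≤ ENNReal.ofReal (C / δ ^ 2) * 2⁻¹ ^ k := by
  have hC : 0 ≤ C := (variance_nonneg _ _).trans (hvar 0)
  have hpow : (2⁻¹ : ℝ≥0∞) ^ k = ENNReal.ofReal (2⁻¹ ^ k) := by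
    rw [ENNReal.ofReal_pow (by norm_num), ENNReal.ofReal_inv_of_pos two_pos, ENNReal.ofReal_ofNat]
  rw [hpow, ← ENNReal.ofReal_mul (by positivity), inv_pow, ← div_eq_mul_inv, div_div]
  simpa [dyadicAverage] using
    measure_le_abs_average_sub_le hX hmean hcov hvar hδ (Nat.two_pow_pos k)

theorem exists_nat_div_btwn {x y : ℝ} (hx : 0 ≤ x) (hxy : x < y) :
    ∃ p d : ℕ, 0 < d ∧ x < (p / d : ℝ) ∧ (p / d : ℝ) < y := by
  obtain ⟨r, hxr, hry⟩ := exists_rat_btwn hxy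
  lift r to ℚ≥0 using mod_cast hx.trans hxr.le
  refine ⟨r.num, r.den, r.den_pos, ?_⟩
  rw [← NNRat.cast_def]
  exact ⟨mod_cast hxr, mod_cast hry⟩

theorem nat_div_le_dyadicAverage_iff {x : ℕ → ℕ} {k p d : ℕ} (hd : 0 < d) :
    (p / d : ℝ) ≤ dyadicAverage (fun j => x j) k ↔
      p * 2 ^ k ≤ d * ∑ j ∈ Finset.range (2 ^ k), x j := by
  rw [dyadicAverage, div_le_div_iff₀ (mod_cast hd) (by positivity), mul_comm _ (d : ℝ)]
  exact_mod_cast Iff.rfl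

theorem dyadicAverage_le_nat_div_iff {x : ℕ → ℕ} {k p d : ℕ} (hd : 0 < d) :
    dyadicAverage (fun j => x j) k ≤ (p / d : ℝ) ↔
      d * ∑ j ∈ Finset.range (2 ^ k), x j ≤ p * 2 ^ k := by
  rw [dyadicAverage, div_le_div_iff₀ (by positivity) (mod_cast hd), mul_comm _ (d : ℝ)]
  exact_mod_cast Iff.rfl

theorem PrimrecFunctional.nat_div_le_dyadicAverage {X : ℕ → (ℕ → Bool) → ℕ}
    (hX : PrimrecFunctional X) {p d : ℕ} (hd : 0 < d) :
    PrimrecFunctional fun k w => decide ((p / d : ℝ) ≤ dyadicAverage (fun j => X j w) k) := by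
  simp only [nat_div_le_dyadicAverage_iff hd]
  exact (hX.sum_range.comp_index primrec_two_pow).map (g := fun k m => decide (p * 2 ^ k ≤ d * m))
    (Primrec.nat_le.comp (Primrec.nat_mul.comp (.const p) (primrec_two_pow.comp .fst))
      (Primrec.nat_mul.comp (.const d) .snd)).decide

theorem PrimrecFunctional.dyadicAverage_le_nat_div {X : ℕ → (ℕ → Bool) → ℕ}
    (hX : PrimrecFunctional X) {p d : ℕ} (hd : 0 < d) :
    PrimrecFunctional fun k w => decide (dyadicAverage (fun j => X j w) k ≤ (p / d : ℝ)) := by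
  simp only [dyadicAverage_le_nat_div_iff hd]
  exact (hX.sum_range.comp_index primrec_two_pow).map (g := fun k m => decide (d * m ≤ p * 2 ^ k))
    (Primrec.nat_le.comp (Primrec.nat_mul.comp (.const d) .snd)
      (Primrec.nat_mul.comp (.const p) (primrec_two_pow.comp .fst))).decide

theorem MLRandomNat.tendsto_dyadicAverage {ν : Measure (ℕ → Bool)} [IsFiniteMeasure ν]
    {z : ℕ → Bool} (hz : MLRandomNat ν z) {X : ℕ → (ℕ → Bool) → ℕ} (hX : PrimrecFunctional X)
    (hL2 : ∀ j, MemLp (fun w => (X j w : ℝ)) 2 ν) {e : ℝ} (hmean : ∀ j, ∫ w, (X j w : ℝ) ∂ν = e)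
    (hcov : Pairwise fun i j => cov[fun w => (X i w : ℝ), fun w => (X j w : ℝ); ν] = 0)
    {C : ℝ} (hvar : ∀ j, Var[fun w => (X j w : ℝ); ν] ≤ C) :
    Tendsto (dyadicAverage fun j => X j z) atTop (𝓝 e) := by
  have he : 0 ≤ e := hmean 0 ▸ integral_nonneg fun w => Nat.cast_nonneg _
  -- The thresholds `p / d` below are rational, which keeps the deviation events decidable.
  have hrare {E : ℕ → (ℕ → Bool) → Prop} [∀ k w, Decidable (E k w)]
      (hE : PrimrecFunctional fun k w => decide (E k w)) {δ : ℝ} (hδ : 0 < δ)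
      (hEδ : ∀ k w, E k w → δ ≤ |dyadicAverage (fun j => (X j w : ℝ)) k - e|) :
      ∀ᶠ k in atTop, ¬ E k z := by
    simp only [← decide_eq_false_iff_not]
    refine hz.eventually_eq_false hE ENNReal.ofReal_ne_top fun k =>
      (measure_mono fun w hw => ?_).trans
        (measure_le_abs_dyadicAverage_sub_le hL2 hmean hcov hvar hδ k)
    exact hEδ k w (of_decide_eq_true hw)
  refine tendsto_order.2 ⟨fun a ha => ?_, fun b hb => ?_⟩
  · rcases lt_or_ge a 0 with ha0 | ha0
    · refine Eventually.of_forall fun k => ha0.trans_le ?_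
      unfold dyadicAverage
      positivity
    · obtain ⟨p, d, hd, hap, hpe⟩ := exists_nat_div_btwn ha0 ha
      have hlow := hrare (hX.dyadicAverage_le_nat_div (p := p) hd) (sub_pos.2 hpe)
        fun k w h => le_abs.2 (.inr (by linarith))
      exact hlow.mono fun k hk => hap.trans (not_le.1 hk)
  · obtain ⟨p, d, hd, hep, hpb⟩ := exists_nat_div_btwn he hb
    have hhigh := hrare (hX.nat_div_le_dyadicAverage (p := p) hd) (sub_pos.2 hep)
      fun k w h => le_abs.2 (.inl (by linarith))
    exact hhigh.mono fun k hk => (not_le.1 hk).trans hpb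

end DyadicAverages

section Signs

variable {Ω : Type*} [MeasurableSpace Ω] {μ : Measure Ω}

/-- The sign `-1` of `true` and `1` of `false`: the nontrivial character of `ℤ/2`, which turns
`xor` into multiplication. -/
def sgn (b : Bool) : ℝ := if b then -1 else 1

theorem sgn_xor (a b : Bool) : sgn (xor a b) = sgn a * sgn b := by
  cases a <;> cases b <;> simp [sgn]

theorem sgn_eq_one_sub (b : Bool) : sgn b = 1 - 2 * (b.toNat : ℝ) := by
  cases b <;> norm_num [sgn]

theorem measurable_sgn : Measurable sgn := measurable_of_countable _

theorem dyadicAverage_sgn (b : ℕ → Bool) (k : ℕ) :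
    dyadicAverage (fun j => sgn (b j)) k =
      1 - 2 * dyadicAverage (fun j => ((b j).toNat : ℝ)) k := by
  simp only [dyadicAverage, sgn_eq_one_sub, Finset.sum_sub_distrib, ← Finset.mul_sum, sub_div,
    mul_div_assoc]
  simp

theorem memLp_comp_of_finite {β E : Type*} [IsFiniteMeasure μ] [Finite β] [MeasurableSpace β]
    [MeasurableSingletonClass β] [NormedAddCommGroup E] (f : β → E) {Y : Ω → β}
    (hY : Measurable Y) (p : ℝ≥0∞) : MemLp (fun w => f (Y w)) p μ := by
  obtain ⟨C, hC⟩ := (Set.finite_range fun b => ‖f b‖).bddAbove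
  exact .of_bound (StronglyMeasurable.of_discrete.comp_measurable hY).aestronglyMeasurable C
    (ae_of_all _ fun w => hC (Set.mem_range_self _))

theorem integral_sgn [IsProbabilityMeasure μ] {Y : Ω → Bool} (hY : Measurable Y) :
    ∫ w, sgn (Y w) ∂μ = 1 - 2 * ∫ w, ((Y w).toNat : ℝ) ∂μ := by
  have hint : Integrable (fun w => ((Y w).toNat : ℝ)) μ :=
    (memLp_comp_of_finite (fun b => (b.toNat : ℝ)) hY 1).integrable le_rfl
  simp only [sgn_eq_one_sub]
  rw [integral_sub (integrable_const _) (hint.const_mul 2), integral_const_mul, integral_const,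
    probReal_univ, one_smul]

theorem covariance_sgn [IsProbabilityMeasure μ] {Y Z : Ω → Bool} (hY : Measurable Y)
    (hZ : Measurable Z) :
    cov[fun w => sgn (Y w), fun w => sgn (Z w); μ] =
      4 * cov[fun w => ((Y w).toNat : ℝ), fun w => ((Z w).toNat : ℝ); μ] := by
  have hint {W : Ω → Bool} (hW : Measurable W) : Integrable (fun w => 2 * ((W w).toNat : ℝ)) μ :=
    ((memLp_comp_of_finite (fun b => (b.toNat : ℝ)) hW 1).integrable le_rfl).const_mul 2
  simp only [sgn_eq_one_sub]
  rw [covariance_const_sub_left (hint hY), covariance_const_sub_right (hint hZ),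
    covariance_const_mul_left, covariance_const_mul_right]
  ring

theorem MLRandomNat.tendsto_dyadicAverage_sgn {ν : Measure (ℕ → Bool)} [IsProbabilityMeasure ν]
    {z : ℕ → Bool} (hz : MLRandomNat ν z) {X : ℕ → (ℕ → Bool) → Bool} (hX : PrimrecFunctional X)
    {e : ℝ} (hmean : ∀ j, ∫ w, sgn (X j w) ∂ν = e)
    (hcov : Pairwise fun i j => cov[fun w => sgn (X i w), fun w => sgn (X j w); ν] = 0) :
    Tendsto (dyadicAverage fun j => sgn (X j z)) atTop (𝓝 e) := by
  have hX' : PrimrecFunctional fun j w => (X j w).toNat :=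
    hX.map ((Primrec.dom_bool Bool.toNat).comp .snd).to₂
  have hL2 (j : ℕ) : MemLp (fun w => ((X j w).toNat : ℝ)) 2 ν :=
    memLp_comp_of_finite (fun b => (b.toNat : ℝ)) (hX.measurable j) 2
  have hlim : Tendsto (dyadicAverage fun j => ((X j z).toNat : ℝ)) atTop (𝓝 ((1 - e) / 2)) := by
    refine hz.tendsto_dyadicAverage hX' hL2 (fun j => ?_)
      (fun i j hij => ?_) (C := ((1 - 0) / 2) ^ 2) fun j => ?_
    · linarith [hmean j, integral_sgn (μ := ν) (hX.measurable j)]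
    · linarith [hcov hij, covariance_sgn (μ := ν) (hX.measurable i) (hX.measurable j)]
    · refine variance_le_sq_of_bounded (ae_of_all _ fun w => ?_)
        (hL2 j).aestronglyMeasurable.aemeasurable
      cases X j w <;> simp
  have hsgn := (hlim.const_mul 2).const_sub 1
  simp only [← dyadicAverage_sgn] at hsgn
  convert hsgn using 2
  ring

end Signs

section Coding

theorem stateCode_two_mul_encode (s : MicroState) (i : ℤ) :
    stateCode s (2 * Encodable.encode i) = s.1 i := by
  rcases i with n | n
  · rw [Int.ofNat_eq_natCast, encode_int_natCast]
    simp [stateCode, kappaCode, iotaCode]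
  · rw [encode_int_negSucc]
    simp only [stateCode, kappaCode, iotaCode]
    rw [if_pos (by omega), if_neg (by omega)]
    exact congrArg s.1 (by omega)

theorem stateCode_two_mul_encode_add_one (s : MicroState) (i : ℤ) :
    stateCode s (2 * Encodable.encode i + 1) = s.2 i := by
  rcases i with n | n
  · rw [Int.ofNat_eq_natCast, encode_int_natCast]
    simp only [stateCode, kappaCode, iotaCode]
    rw [if_neg (by omega), if_pos (by omega)]
    exact congrArg s.2 (by omega)
  · rw [encode_int_negSucc]
    simp only [stateCode, kappaCode, iotaCode]
    rw [if_neg (by omega), if_neg (by omega)]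
    exact congrArg s.2 (by omega)

/-- The inverse of `stateCode`. Mathlib encodes `0, -1, 1, -2, …` as `0, 1, 2, 3, …`, the order
in which `iotaCode` lists the sites. -/
def stateDecode (w : ℕ → Bool) : MicroState :=
  (fun i => w (2 * Encodable.encode i), fun i => w (2 * Encodable.encode i + 1))

theorem stateDecode_stateCode (s : MicroState) : stateDecode (stateCode s) = s :=
  Prod.ext (funext (stateCode_two_mul_encode s)) (funext (stateCode_two_mul_encode_add_one s))

theorem measurable_stateCode : Measurable stateCode := by
  refine measurable_pi_lambda _ fun n => ?_
  simp only [stateCode, kappaCode, iotaCode]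
  split_ifs <;> fun_prop

theorem MLRandom.tendsto_dyadicAverage_sgn {μ : Measure MicroState} [IsProbabilityMeasure μ]
    {s : MicroState} (hs : MLRandom μ s) {X : ℕ → MicroState → Bool}
    (hX : PrimrecFunctional fun j w => X j (stateDecode w)) {e : ℝ}
    (hmean : ∀ j, ∫ u, sgn (X j u) ∂μ = e)
    (hcov : Pairwise fun i j => cov[fun u => sgn (X i u), fun u => sgn (X j u); μ] = 0) :
    Tendsto (dyadicAverage fun j => sgn (X j s)) atTop (𝓝 e) := by
  have hcode := measurable_stateCode.aemeasurable (μ := μ)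
  have : IsProbabilityMeasure (μ.map stateCode) := Measure.isProbabilityMeasure_map hcode
  have hmeas (j : ℕ) : AEStronglyMeasurable (fun w => sgn (X j (stateDecode w)))
      (μ.map stateCode) := (measurable_sgn.comp (hX.measurable j)).aestronglyMeasurable
  have hlim := MLRandomNat.tendsto_dyadicAverage_sgn hs hX (e := e) (fun j => ?_)
    fun i j hij => ?_
  · simpa only [stateDecode_stateCode] using hlim
  · rw [integral_map hcode (hmeas j)]
    simpa only [stateDecode_stateCode] using hmean j
  · beta_reduce
    rw [covariance_map (hmeas i) (hmeas j) hcode]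
    simpa only [Function.comp_def, stateDecode_stateCode] using hcov hij

/-- A map into microscopic states whose spins and scatterers are primitive recursive functionals,
uniformly in the site. -/
structure PrimrecState (V : (ℕ → Bool) → MicroState) : Prop where
  spins : PrimrecFunctional fun (i : ℤ) w => (V w).1 i
  scatterers : PrimrecFunctional fun (i : ℤ) w => (V w).2 i

namespace PrimrecState

variable {V : (ℕ → Bool) → MicroState}

theorem stateDecode : PrimrecState stateDecode where
  spins := .eval (Primrec.nat_double.comp .encode)
  scatterers := .eval (Primrec.nat_double_succ.comp .encode)

theorem kacStep (hV : PrimrecState V) : PrimrecState fun w => kacStep (V w) where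
  spins := .map₂ (g := xor) (Primrec.dom_bool₂ _) (hV.spins.comp_index primrec_int_pred)
    (hV.scatterers.comp_index primrec_int_pred)
  scatterers := hV.scatterers

theorem iterate_kacStep (hV : PrimrecState V) (t : ℕ) :
    PrimrecState fun w => _root_.kacStep^[t] (V w) := by
  induction t with
  | zero => exact hV
  | succ t ih => simpa only [Function.iterate_succ_apply'] using ih.kacStep

theorem timeReversal (hV : PrimrecState V) : PrimrecState fun w => timeReversal (V w) where
  spins := hV.spins.comp_index primrec_int_neg
  scatterers := hV.scatterers.comp_index (primrec_int_pred.comp primrec_int_neg)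

end PrimrecState

end Coding

section Dynamics

theorem measurable_kacStep : Measurable kacStep := by
  refine Measurable.prodMk (measurable_pi_lambda _ fun i => ?_) measurable_snd
  exact (measurable_of_countable fun p : Bool × Bool => xor p.1 p.2).comp
    (by fun_prop : Measurable fun s : MicroState => (s.1 (i - 1), s.2 (i - 1)))

theorem measurable_timeReversal : Measurable timeReversal := by
  unfold timeReversal
  fun_prop

theorem timeReversal_involutive : Function.Involutive timeReversal := fun s => by
  simp [timeReversal]

theorem kacStep_timeReversal_kacStep (s : MicroState) :
    kacStep (timeReversal (kacStep s)) = timeReversal s := by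
  refine Prod.ext (funext fun i => ?_) rfl
  simp [kacStep, timeReversal]

theorem iterate_kacStep_timeReversal_iterate_kacStep (t : ℕ) (s : MicroState) :
    kacStep^[t] (timeReversal (kacStep^[t] s)) = timeReversal s := by
  induction t with
  | zero => rfl
  | succ t ih =>
    rw [Function.iterate_succ_apply, Function.iterate_succ_apply', kacStep_timeReversal_kacStep, ih]

theorem iterate_kacStep_snd (t : ℕ) (s : MicroState) : (kacStep^[t] s).2 = s.2 := by
  induction t with
  | zero => rfl
  | succ t ih => rw [Function.iterate_succ_apply', ← ih]; rfl

theorem sgn_iterate_kacStep (t : ℕ) (s : MicroState) (i : ℤ) :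
    sgn ((kacStep^[t] s).1 i) = sgn (s.1 (i - t)) * ∏ b ∈ Finset.Ico (i - t) i, sgn (s.2 b) := by
  induction t generalizing i with
  | zero => simp
  | succ t ih =>
    have hIco : insert (i - 1) (Finset.Ico (i - 1 - t) (i - 1)) =
        Finset.Ico (i - (t + 1 : ℕ)) i := by
      ext b
      simp only [Finset.mem_insert, Finset.mem_Ico]
      omega
    rw [Function.iterate_succ_apply', ← hIco, Finset.prod_insert Finset.right_notMem_Ico]
    change sgn (xor ((kacStep^[t] s).1 (i - 1)) ((kacStep^[t] s).2 (i - 1))) = _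
    rw [sgn_xor, ih, iterate_kacStep_snd,
      show i - 1 - (t : ℤ) = i - (t + 1 : ℕ) by push_cast; ring]
    ring

end Dynamics

section GibbsMeasure

instance (p : unitInterval) : IsProbabilityMeasure (bernoulliInt p) := by
  unfold bernoulliInt
  infer_instance

instance (m₀ : Set.Icc (-1 : ℝ) 1) (m₁ : unitInterval) :
    IsProbabilityMeasure (gibbsMeasure m₀ m₁) := by
  unfold gibbsMeasure
  infer_instance

instance (m₀ : Set.Icc (-1 : ℝ) 1) (m₁ : unitInterval) (t : ℕ) :
    IsProbabilityMeasure (gibbsMeasureAt m₀ m₁ t) :=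
  Measure.isProbabilityMeasure_map (measurable_kacStep.iterate t).aemeasurable

theorem integral_sgn_bernoulliMeasure (p : unitInterval) :
    ∫ b, sgn b ∂bernoulliMeasure true false p = 1 - 2 * (p : ℝ) := by
  rw [integral_bernoulliMeasure]
  simp only [sgn, smul_eq_mul, if_true, Bool.false_eq_true, if_false]
  ring

theorem integral_prod_sgn_bernoulliInt (p : unitInterval) (A : Finset ℤ) :
    ∫ x, ∏ a ∈ A, sgn (x a) ∂bernoulliInt p = (1 - 2 * (p : ℝ)) ^ A.card := by
  calc ∫ x, ∏ a ∈ A, sgn (x a) ∂bernoulliInt p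
      = ∫ x, ∏ a : A, sgn (A.restrict x a) ∂bernoulliInt p := by
        simp only [← Finset.prod_coe_sort A, Finset.restrict]
    _ = ∫ y : A → Bool, ∏ a : A, sgn (y a) ∂Measure.pi fun _ => bernoulliMeasure true false p :=
        integral_restrict_infinitePi (X := fun _ : ℤ => Bool) _ (s := A)
          (f := fun y : A → Bool => ∏ a, sgn (y a)) (measurable_of_countable _).aestronglyMeasurable
    _ = (1 - 2 * (p : ℝ)) ^ A.card := by
        rw [integral_fintype_prod_eq_prod fun _ : A => sgn]
        simp [integral_sgn_bernoulliMeasure]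

theorem integral_prod_sgn_gibbsMeasure (m₀ : Set.Icc (-1 : ℝ) 1) (m₁ : unitInterval)
    (A B : Finset ℤ) :
    ∫ s, (∏ a ∈ A, sgn (s.1 a)) * ∏ b ∈ B, sgn (s.2 b) ∂gibbsMeasure m₀ m₁ =
      (-(m₀ : ℝ)) ^ A.card * (1 - 2 * (m₁ : ℝ)) ^ B.card := by
  have hup : 1 - 2 * (upProb m₀ : ℝ) = -m₀ := by
    simp only [upProb]
    ring
  rw [gibbsMeasure, integral_prod_mul (fun x : ℤ → Bool => ∏ a ∈ A, sgn (x a))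
    fun y : ℤ → Bool => ∏ b ∈ B, sgn (y b), integral_prod_sgn_bernoulliInt,
    integral_prod_sgn_bernoulliInt, hup]

theorem integral_sgn_iterate_kacStep (m₀ : Set.Icc (-1 : ℝ) 1) (m₁ : unitInterval) (n : ℕ)
    (i : ℤ) :
    ∫ s, sgn ((kacStep^[n] s).1 i) ∂gibbsMeasure m₀ m₁ = -m₀ * (1 - 2 * (m₁ : ℝ)) ^ n := by
  simpa [sgn_iterate_kacStep] using
    integral_prod_sgn_gibbsMeasure m₀ m₁ {i - (n : ℤ)} (Finset.Ico (i - n) i)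

theorem integral_sgn_mul_sgn_iterate_kacStep (m₀ : Set.Icc (-1 : ℝ) 1) (m₁ : unitInterval)
    {n : ℕ} {i j : ℤ} (hij : i ≠ j) (hn : (n : ℤ) ≤ |i - j|) :
    ∫ s, sgn ((kacStep^[n] s).1 i) * sgn ((kacStep^[n] s).1 j) ∂gibbsMeasure m₀ m₁ =
      (-m₀ * (1 - 2 * (m₁ : ℝ)) ^ n) ^ 2 := by
  have hspins : i - (n : ℤ) ≠ j - n := by simpa using hij
  have hscatterers : Disjoint (Finset.Ico (i - (n : ℤ)) i) (Finset.Ico (j - (n : ℤ)) j) := by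
    refine Finset.disjoint_left.2 fun b hi hj => ?_
    rw [Finset.mem_Ico] at hi hj
    grind
  have hprod := integral_prod_sgn_gibbsMeasure m₀ m₁ {i - (n : ℤ), j - (n : ℤ)}
    (Finset.Ico (i - (n : ℤ)) i ∪ Finset.Ico (j - (n : ℤ)) j)
  simp only [Finset.prod_pair hspins, Finset.card_pair hspins, Finset.prod_union hscatterers,
    Finset.card_union_of_disjoint hscatterers, Int.card_Ico, sub_sub_cancel, Int.toNat_natCast]
    at hprod
  simp only [sgn_iterate_kacStep, mul_mul_mul_comm, hprod]
  ring

theorem measurable_iterate_kacStep_spin (n : ℕ) (i : ℤ) :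
    Measurable fun s : MicroState => (kacStep^[n] s).1 i :=
  (measurable_pi_apply i).comp (measurable_fst.comp (measurable_kacStep.iterate n))

theorem covariance_sgn_iterate_kacStep (m₀ : Set.Icc (-1 : ℝ) 1) (m₁ : unitInterval) {n : ℕ}
    {i j : ℤ} (hij : i ≠ j) (hn : (n : ℤ) ≤ |i - j|) :
    cov[fun s => sgn ((kacStep^[n] s).1 i), fun s => sgn ((kacStep^[n] s).1 j);
      gibbsMeasure m₀ m₁] = 0 := by
  rw [covariance_eq_sub (memLp_comp_of_finite sgn (measurable_iterate_kacStep_spin n i) 2)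
    (memLp_comp_of_finite sgn (measurable_iterate_kacStep_spin n j) 2)]
  simp only [Pi.mul_apply, integral_sgn_mul_sgn_iterate_kacStep m₀ m₁ hij hn,
    integral_sgn_iterate_kacStep]
  ring

end GibbsMeasure

section NonRandomness

variable {m₀ : Set.Icc (-1 : ℝ) 1} {m₁ : unitInterval}

theorem MLRandom.tendsto_dyadicAverage_iterate_kacStep {s : MicroState}
    (hs : MLRandom (gibbsMeasure m₀ m₁) s) {n d : ℕ} (hd : 0 < d) (hnd : n ≤ d) :
    Tendsto (dyadicAverage fun j => sgn ((kacStep^[n] s).1 (d * j))) atTop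
      (𝓝 (-m₀ * (1 - 2 * (m₁ : ℝ)) ^ n)) := by
  refine hs.tendsto_dyadicAverage_sgn (X := fun j s => (kacStep^[n] s).1 (d * j))
    ((PrimrecState.stateDecode.iterate_kacStep n).spins.comp_index (primrec_natCast_int_mul d))
    (fun j => integral_sgn_iterate_kacStep m₀ m₁ n _) fun i j hij => ?_
  have hdist : (1 : ℤ) ≤ |(i : ℤ) - j| := Int.one_le_abs (by omega)
  have hsep : (d : ℤ) ≤ |(d * i - d * j : ℤ)| := by
    rw [← mul_sub, abs_mul, Nat.abs_cast]
    exact le_mul_of_one_le_right (by positivity) hdist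
  exact covariance_sgn_iterate_kacStep m₀ m₁ (by simpa [hd.ne'] using hij)
    ((Nat.cast_le.2 hnd).trans hsep)

theorem MLRandom.tendsto_dyadicAverage_iterate_kacStep_timeReversal {t : ℕ} {u : MicroState}
    (hu : MLRandom (gibbsMeasureAt m₀ m₁ t) u) {d : ℕ} (hd : 0 < d) :
    Tendsto (dyadicAverage fun j => sgn ((kacStep^[t] (timeReversal u)).1 (d * j))) atTop
      (𝓝 (-m₀)) := by
  have hφ := (measurable_kacStep.iterate t).aemeasurable (μ := gibbsMeasure m₀ m₁)
  have hobs (i : ℤ) : AEStronglyMeasurable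
      (fun u : MicroState => sgn ((kacStep^[t] (timeReversal u)).1 i)) (gibbsMeasureAt m₀ m₁ t) :=
    ((measurable_sgn.comp (measurable_iterate_kacStep_spin t i)).comp
      measurable_timeReversal).aestronglyMeasurable
  have hspin (s : MicroState) (i : ℤ) :
      (kacStep^[t] (timeReversal (kacStep^[t] s))).1 i = s.1 (-i) := by
    rw [iterate_kacStep_timeReversal_iterate_kacStep, timeReversal]
  refine hu.tendsto_dyadicAverage_sgn (X := fun j u => (kacStep^[t] (timeReversal u)).1 (d * j))
    ((PrimrecState.stateDecode.timeReversal.iterate_kacStep t).spins.comp_index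
      (primrec_natCast_int_mul d)) (fun j => ?_) fun i j hij => ?_
  · rw [gibbsMeasureAt, integral_map hφ (hobs _)]
    simpa only [hspin, Function.iterate_zero, id, pow_zero, mul_one] using
      integral_sgn_iterate_kacStep m₀ m₁ 0 (-(d * j : ℤ))
  · beta_reduce
    rw [gibbsMeasureAt, covariance_map (hobs _) (hobs _) hφ]
    simpa only [Function.comp_def, hspin, Function.iterate_zero, id] using
      covariance_sgn_iterate_kacStep m₀ m₁ (n := 0) (i := -(d * i : ℤ)) (j := -(d * j : ℤ))
        (by simpa [hd.ne'] using hij) (by simp)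

end NonRandomness

theorem theorem4_general (m₀ : Set.Icc (-1 : ℝ) 1) (m₁ : unitInterval) (hm₀ : (m₀ : ℝ) ≠ 0)
    (hm₁ : (m₁ : ℝ) ≠ 0) (hm₁_one : (m₁ : ℝ) ≠ 1) (s : MicroState)
    (hs : MLRandom (gibbsMeasure m₀ m₁) s) (t : ℕ) (ht : t ≠ 0) :
    ¬ MLRandom (gibbsMeasureAt m₀ m₁ t) (timeReversal (kacStep^[t] s)) := by
  intro hu
  have hd : 0 < 2 * t := by positivity
  have hrev := hu.tendsto_dyadicAverage_iterate_kacStep_timeReversal hd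
  simp only [timeReversal_involutive _, ← Function.iterate_add_apply, ← two_mul] at hrev
  have hfwd := hs.tendsto_dyadicAverage_iterate_kacStep hd le_rfl
  have hlim := tendsto_nhds_unique hrev hfwd
  have hlt : (1 - 2 * (m₁ : ℝ)) ^ (2 * t) < 1 := by
    have h0 : 0 < (m₁ : ℝ) := m₁.2.1.lt_of_ne' hm₁
    have h1 : (m₁ : ℝ) < 1 := m₁.2.2.lt_of_ne hm₁_one
    rw [pow_mul]
    exact pow_lt_one₀ (sq_nonneg _) (by nlinarith) ht
  exact hlt.ne' (mul_left_cancel₀ (neg_ne_zero.2 hm₀) (by rwa [mul_one]))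

theorem theorem4 (m₀ : Set.Icc (-1 : ℝ) 1) (m₁ : unitInterval)
    (hc₀ : ComputableReal (m₀ : ℝ)) (hc₁ : ComputableReal (m₁ : ℝ))
    (hm₀ : (m₀ : ℝ) ≠ 0)
    (hm₁ : (m₁ : ℝ) ≠ 0) (hm₁_half : (m₁ : ℝ) ≠ 1 / 2) (hm₁_one : (m₁ : ℝ) ≠ 1)
    (s : MicroState) (hs : MLRandom (gibbsMeasure m₀ m₁) s)
    (t : ℕ) (ht : t ≠ 0) :
    ¬ MLRandom (gibbsMeasureAt m₀ m₁ t) (timeReversal (kacStep^[t] s)) :=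
  theorem4_general m₀ m₁ hm₀ hm₁ hm₁_one s hs t ht
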